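/- Let $M$ be a compact connected $C^1$ manifold (possibly with boundary or corners) with a distance $d$ inducing its topology, and let $m$ be a Lebesgue probability on $M$, that is, a Borel probability measure which in charts has a continuous, strictly positive density with respect to Lebesgue measure (for instance the normalized volume of a Riemannian metric). Let $X=M^{\mathbb N}$, with the shift $\sigma(x_0,x_1,x_2,\dots)=(x_1,x_2,\dots)$ and the distance $d(x,y)=\sum_{n\ge 0}2^{-(n+1)}d(x_n,y_n)$, and let $f:X\to\mathbb R$ be Hölder continuous. For $c\in\mathbb R$ let $$L_{cf}(w)(x)=\int_M e^{c f(ax)}\,w(ax)\,dm(a),\qquad ax=(a,x_0,x_1,\dots),$$ be the Ruelle operator of $cf$ on continuous functions $w:X\to\mathbb R$. A Gibbs probability of $cf$ is a probability $\mu_c=h_c\nu_c$ on $X$, where, for some $\beta_c>0$, $h_c$ is a continuous strictly positive function with $L_{cf}h_c=\beta_c h_c$, $\nu_c$ is a Borel probability on $X$ with $L_{cf}^*\nu_c=\beta_c\nu_c$ (i.e. $\int L_{cf}w\,d\nu_c=\beta_c\int w\,d\nu_c$ for all continuous $w$), and $\int h_c\,d\nu_c=1$. If $c_j\to+\infty$,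 if $\mu_{c_j}$ is a Gibbs probability of $c_jf$ for each $j$, and if $\mu_{c_j}$ converges weakly$^*$ to a probability $\mu$ on $X$, then $\mu$ is a maximizing probability for $f$: it is $\sigma$-invariant, and $$\int f\,d\mu=\beta(f):=\max\Big\{\int f\,d\eta:\ \eta\ \text{a $\sigma$-invariant Borel probability on }X\Big\}.$$ Uniqueness of the maximizing probability is not assumed. -/

import Mathlib

open MeasureTheory Filter Topology
open scoped Manifold

namespace XYModel

section Sequences

variable {M : Type*}

/-- The sequence `ax = (a, x₀, x₁, x₂, …)`. -/
def cons (a : M) (x : ℕ → M) : ℕ → M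
  | 0 => a
  | n + 1 => x n

/-- The shift `σ (x₀, x₁, x₂, …) = (x₁, x₂, x₃, …)`. -/
def shift (x : ℕ → M) : ℕ → M := fun n => x (n + 1)

/-- The distance `d(x, y) = ∑ₙ 2⁻⁽ⁿ⁺¹⁾ d(xₙ, yₙ)` induced on the space of sequences by the distance
of `M` (the series converges when `M` is bounded, in particular when `M` is compact). -/
noncomputable def seqDist [MetricSpace M] (x y : ℕ → M) : ℝ :=
  ∑' n : ℕ, (1 / 2 : ℝ) ^ (n + 1) * dist (x n) (y n)

/-- Hölder functions on the space of sequences. -/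
def IsHolder [MetricSpace M] (f : (ℕ → M) → ℝ) : Prop :=
  ∃ C α : ℝ, 0 < α ∧ α ≤ 1 ∧ ∀ x y : ℕ → M, |f x - f y| ≤ C * seqDist x y ^ α

end Sequences

section Lebesgue

variable {n : ℕ} {H : Type*} [TopologicalSpace H] {M : Type*} [TopologicalSpace M]
  [ChartedSpace H M] [MeasurableSpace M]

/-- `m` is a Lebesgue probability on the manifold `M`: a probability measure that in every
preferred chart has a continuous and strictly positive density with respect to the Lebesgue measure
of `ℝⁿ`. The normalized volume of any (continuous) Riemannian metric on a compact manifold is an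
example, with density a constant times `√(det gᵢⱼ)`. -/
def IsLebesgueProbability (I : ModelWithCorners ℝ (EuclideanSpace ℝ (Fin n)) H)
    (m : Measure M) : Prop :=
  IsProbabilityMeasure m ∧
    ∀ p : M, ∃ ρ : EuclideanSpace ℝ (Fin n) → ℝ,
      ContinuousOn ρ (extChartAt I p).target ∧
      (∀ y ∈ (extChartAt I p).target, 0 < ρ y) ∧
      ∀ s ⊆ (extChartAt I p).source, MeasurableSet s →
        m s = ∫⁻ y in extChartAt I p '' s, ENNReal.ofReal (ρ y)

end Lebesgue

section Ruelle

variable {M : Type*} [TopologicalSpace M] [MeasurableSpace M]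

/-- The Ruelle operator `(L_g w)(x) = ∫ e^{g(ax)} w(ax) dm(a)` with a priori measure `m`. -/
noncomputable def ruelle (m : Measure M) (g w : (ℕ → M) → ℝ) : (ℕ → M) → ℝ :=
  fun x => ∫ a, Real.exp (g (cons a x)) * w (cons a x) ∂m

/-- `h` is a continuous strictly positive eigenfunction of `L_g`, for the eigenvalue `b`. -/
def IsEigenfunction (m : Measure M) (g : (ℕ → M) → ℝ) (b : ℝ) (h : (ℕ → M) → ℝ) : Prop :=
  Continuous h ∧ (∀ x, 0 < h x) ∧ ∀ x, ruelle m g h x = b * h x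

/-- The probability measure `ν` is an eigenmeasure of the dual operator: `L_g^* ν = b ν`, that is
`∫ L_g w dν = b ∫ w dν` for every continuous `w`. -/
def IsEigenmeasure (m : Measure M) (g : (ℕ → M) → ℝ) (b : ℝ) (ν : Measure (ℕ → M)) : Prop :=
  IsProbabilityMeasure ν ∧
    ∀ w : (ℕ → M) → ℝ, Continuous w → ∫ x, ruelle m g w x ∂ν = b * ∫ x, w x ∂ν

/-- `μ` is a Gibbs probability of the potential `g`: `μ = h ν` with `h` a positive eigenfunction
of `L_g` and `ν` an eigenmeasure of its dual, for the same eigenvalue `b > 0`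
(as `μ` is a probability, `h` is normalized by `∫ h dν = 1`). -/
def IsGibbs (m : Measure M) (g : (ℕ → M) → ℝ) (μ : ProbabilityMeasure (ℕ → M)) : Prop :=
  ∃ (b : ℝ) (h : (ℕ → M) → ℝ) (ν : Measure (ℕ → M)),
    0 < b ∧ IsEigenfunction m g b h ∧ IsEigenmeasure m g b ν ∧
      (μ : Measure (ℕ → M)) = ν.withDensity (fun x => ENNReal.ofReal (h x))

end Ruelle

section Maximizing

variable {M : Type*} [MeasurableSpace M]

/-- The set `𝓜_σ` of shift-invariant probability measures. -/
def invariantMeasures (M : Type*) [MeasurableSpace M] : Set (ProbabilityMeasure (ℕ → M)) :=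
  {μ | MeasurePreserving (shift : (ℕ → M) → ℕ → M) (μ : Measure (ℕ → M)) μ}

/-- `μ` is a maximizing probability for `f`: it is invariant, and `∫ f dμ` is the maximum of
`∫ f dη` over all invariant probability measures `η`. -/
def IsMaximizing (f : (ℕ → M) → ℝ) (μ : ProbabilityMeasure (ℕ → M)) : Prop :=
  μ ∈ invariantMeasures M ∧
    IsGreatest ((fun η : ProbabilityMeasure (ℕ → M) => ∫ x, f x ∂(η : Measure (ℕ → M))) ''
      invariantMeasures M) (∫ x, f x ∂(μ : Measure (ℕ → M)))

/-- `β(f)`, the supremum of `∫ f dη` over the invariant probability measures `η`. -/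
noncomputable def maxValue (f : (ℕ → M) → ℝ) : ℝ :=
  sSup ((fun η : ProbabilityMeasure (ℕ → M) => ∫ x, f x ∂(η : Measure (ℕ → M))) ''
      invariantMeasures M)

end Maximizing

end XYModel

/-! The eigenvalue `b` of `L_{cf}` is squeezed between two integrals. On one side, `log b ≤ c ∫ f
dμ_c`: the relative entropy of the Gibbs probability is nonpositive, which comes from `log t ≤ t -
1` (`IsGibbs.exists_log_le_integral`). On the other, for every invariant `η`, `log κ + c (∫ f dη -
ε) ≤ log b` (`IsEigenfunction.le_log`), where `f` varies by at most `ε` at coordinatewise scale `δ`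
and every `δ`-ball has `m`-measure at least `κ > 0`. Since `κ` does not depend on `c`, dividing by
`c` and letting `c → ∞` removes `log κ`; then `ε → 0`. Of `m`, only its being a probability with
full support matters. -/

namespace XYModel

/-! ### Full support of a Lebesgue probability. -/

section Manifold

variable {n : ℕ} {H : Type*} [TopologicalSpace H] {M : Type*} [TopologicalSpace M]
  [ChartedSpace H M] [MeasurableSpace M]

/-- A Lebesgue probability charges every nonempty open set. -/
theorem IsLebesgueProbability.isOpenPosMeasure [OpensMeasurableSpace M]
    {I : ModelWithCorners ℝ (EuclideanSpace ℝ (Fin n)) H} {m : Measure M}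
    (hm : IsLebesgueProbability I m) : m.IsOpenPosMeasure := by
  refine ⟨fun U hU ⟨p, hp⟩ hU0 => ?_⟩
  obtain ⟨ρ, hρc, hρ, hms⟩ := hm.2 p
  set φ := extChartAt I p
  have hs : IsOpen (U ∩ φ.source) := hU.inter (isOpen_extChartAt_source p)
  have himg : φ '' (U ∩ φ.source) ∈ 𝓝[Set.range I] (φ p) := by
    rw [← map_extChartAt_nhds]
    exact image_mem_map (hs.mem_nhds ⟨hp, mem_extChartAt_source p⟩)
  obtain ⟨V, hV, hpV, hVs⟩ := mem_nhdsWithin.1 himg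
  have hpI : φ p ∈ Set.range I := extChartAt_target_subset_range p (mem_extChartAt_target p)
  -- At a boundary point the chart image need not be open in `ℝⁿ`, but `range I` lies in the closure
  -- of its interior, so the image still contains a nonempty open set.
  have hW : (V ∩ interior (Set.range I)).Nonempty :=
    mem_closure_iff.1 (I.range_subset_closure_interior hpI) V hV hpV
  have hWo : IsOpen (V ∩ interior (Set.range I)) := hV.inter isOpen_interior
  have hWs : V ∩ interior (Set.range I) ⊆ φ '' (U ∩ φ.source) :=
    (Set.inter_subset_inter_right _ interior_subset).trans hVs
  have hWt : V ∩ interior (Set.range I) ⊆ φ.target := by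
    refine hWs.trans ?_
    rintro _ ⟨q, hq, rfl⟩
    exact φ.map_source hq.2
  have h0 : ∫⁻ y in V ∩ interior (Set.range I), ENNReal.ofReal (ρ y) = 0 := by
    refine le_antisymm ?_ zero_le
    calc _ ≤ ∫⁻ y in φ '' (U ∩ φ.source), ENNReal.ofReal (ρ y) := lintegral_mono_set hWs
      _ = m (U ∩ φ.source) := (hms _ Set.inter_subset_right hs.measurableSet).symm
      _ ≤ m U := measure_mono Set.inter_subset_left
      _ = 0 := hU0
  have hmeas : AEMeasurable (fun y => ENNReal.ofReal (ρ y))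
      (volume.restrict (V ∩ interior (Set.range I))) :=
    ((hρc.mono hWt).aemeasurable hWo.measurableSet).ennreal_ofReal
  rw [lintegral_eq_zero_iff' hmeas, Filter.EventuallyEq, ae_restrict_iff' hWo.measurableSet] at h0
  refine (hWo.measure_pos volume hW).ne' (measure_mono_null (fun y hy => ?_) h0)
  simpa only [Set.mem_compl_iff, Set.mem_ofPred_eq, hy, forall_const, Pi.zero_apply,
    ENNReal.ofReal_eq_zero, not_le] using hρ y (hWt hy)

end Manifold

/-! ### Topology and moduli of continuity on the sequence space. -/

section Sequences

theorem continuous_shift {M : Type*} [TopologicalSpace M] :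
    Continuous (shift : (ℕ → M) → ℕ → M) :=
  continuous_pi fun n => continuous_apply (n + 1)

theorem continuous_cons {M : Type*} [TopologicalSpace M] (x : ℕ → M) :
    Continuous fun a => cons a x :=
  continuous_pi fun
    | 0 => continuous_id
    | _ + 1 => continuous_const

theorem shift_cons {M : Type*} (a : M) (x : ℕ → M) : shift (cons a x) = x := rfl

variable {M : Type*} [MetricSpace M]

theorem hasSum_half_pow_mul (D : ℝ) : HasSum (fun n : ℕ => (1 / 2 : ℝ) ^ (n + 1) * D) D := by
  have h := (hasSum_geometric_two.mul_left (1 / 2 : ℝ)).mul_right D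
  simpa [pow_succ', mul_assoc] using h

theorem seqDist_nonneg (x y : ℕ → M) : 0 ≤ seqDist x y :=
  tsum_nonneg fun _ => by positivity

theorem seqDist_self (x : ℕ → M) : seqDist x x = 0 := by simp [seqDist]

theorem seqDist_le {x y : ℕ → M} {δ : ℝ} (h : ∀ i, dist (x i) (y i) ≤ δ) :
    seqDist x y ≤ δ := by
  have hle : ∀ n : ℕ, (1 / 2 : ℝ) ^ (n + 1) * dist (x n) (y n) ≤ (1 / 2 : ℝ) ^ (n + 1) * δ :=
    fun n => by gcongr; exact h n
  have hs := hasSum_half_pow_mul δ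
  exact ((Summable.of_nonneg_of_le (fun _ => by positivity) hle hs.summable).tsum_le_tsum hle
    hs.summable).trans_eq hs.tsum_eq

variable [CompactSpace M]

theorem continuous_seqDist (x : ℕ → M) : Continuous (seqDist x) := by
  refine continuous_tsum (u := fun n : ℕ => (1 / 2 : ℝ) ^ (n + 1) * Metric.diam (Set.univ : Set M))
    (fun n => by fun_prop) (hasSum_half_pow_mul _).summable fun n y => ?_
  rw [Real.norm_of_nonneg (by positivity)]
  gcongr
  exact Metric.dist_le_diam_of_mem isCompact_univ.isBounded (Set.mem_univ _) (Set.mem_univ _)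

theorem IsHolder.continuous {f : (ℕ → M) → ℝ} (hf : IsHolder f) : Continuous f := by
  obtain ⟨C, α, hα, -, h⟩ := hf
  refine continuous_iff_continuousAt.2 fun x => ?_
  have h0 : Tendsto (fun y => C * seqDist x y ^ α) (𝓝 x) (𝓝 0) := by
    have := (((continuous_seqDist x).tendsto x).rpow_const (Or.inr hα.le)).const_mul C
    simpa [seqDist_self, Real.zero_rpow hα.ne'] using this
  refine tendsto_iff_dist_tendsto_zero.2
    (squeeze_zero (fun _ => dist_nonneg) (fun y => ?_) h0)
  rw [dist_comm, Real.dist_eq]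
  exact h x y

omit [CompactSpace M] in
theorem IsHolder.exists_modulus {f : (ℕ → M) → ℝ} (hf : IsHolder f) {ε : ℝ} (hε : 0 < ε) :
    ∃ δ > 0, ∀ x y : ℕ → M, (∀ i, dist (x i) (y i) < δ) → |f x - f y| ≤ ε := by
  obtain ⟨C, α, hα, -, h⟩ := hf
  have h0 : Tendsto (fun t : ℝ => |C| * t ^ α) (𝓝 0) (𝓝 0) := by
    have := ((tendsto_id (x := 𝓝 (0 : ℝ))).rpow_const (Or.inr hα.le)).const_mul |C|
    simpa [Real.zero_rpow hα.ne'] using this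
  obtain ⟨δ, hδ, hball⟩ := Metric.eventually_nhds_iff.1 (h0.eventually (gt_mem_nhds hε))
  refine ⟨δ / 2, half_pos hδ, fun x y hxy => ?_⟩
  have hd : seqDist x y ≤ δ / 2 := seqDist_le fun i => (hxy i).le
  calc |f x - f y| ≤ C * seqDist x y ^ α := h x y
    _ ≤ |C| * seqDist x y ^ α := by
        -- The Hölder constant `C` is not assumed nonnegative, hence `|C|`.
        gcongr
        · exact Real.rpow_nonneg (seqDist_nonneg x y) α
        · exact le_abs_self C
    _ ≤ ε := by
        refine (hball ?_).le
        rw [Real.dist_0_eq_abs, abs_of_nonneg (seqDist_nonneg x y)]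
        linarith

end Sequences

theorem integrable_of_continuous {X : Type*} [TopologicalSpace X] [CompactSpace X]
    [MeasurableSpace X] [OpensMeasurableSpace X] (μ : Measure X) [IsFiniteMeasure μ] {w : X → ℝ}
    (hw : Continuous w) : Integrable w μ :=
  hw.integrable_of_hasCompactSupport (HasCompactSupport.of_compactSpace w)

/-- On a compact metric space, the balls of a given radius have uniformly positive measure for a
finite measure with full support. -/
theorem exists_pos_le_measureReal_ball {M : Type*} [MetricSpace M] [CompactSpace M]
    [MeasurableSpace M] (m : Measure M) [IsFiniteMeasure m] [m.IsOpenPosMeasure] {δ : ℝ}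
    (hδ : 0 < δ) : ∃ κ > 0, ∀ a, κ ≤ m.real (Metric.ball a δ) := by
  obtain ⟨t, -, ht⟩ := isCompact_univ.elim_finite_subcover_image (b := (Set.univ : Set M))
    (c := fun a => Metric.ball a (δ / 2)) (fun _ _ => Metric.isOpen_ball)
    (fun a _ => Set.mem_biUnion (Set.mem_univ a) (Metric.mem_ball_self (half_pos hδ)))
  obtain ⟨htf, hcov⟩ := ht
  have hpos : ∀ a : M, 0 < m.real (Metric.ball a (δ / 2)) := fun a =>
    ENNReal.toReal_pos (Metric.measure_ball_pos m a (half_pos hδ)).ne' (measure_ne_top _ _)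
  -- Each `δ`-ball contains one of the finitely many `δ/2`-balls of the cover, so the least of their
  -- measures serves as `κ`.
  have hsub : ∀ a : M, ∃ p ∈ t, m.real (Metric.ball p (δ / 2)) ≤ m.real (Metric.ball a δ) := by
    intro a
    obtain ⟨p, hp, hap⟩ := Set.mem_iUnion₂.1 (hcov (Set.mem_univ a))
    refine ⟨p, hp, measureReal_mono (Metric.ball_subset_ball' ?_)⟩
    rw [Metric.mem_ball, dist_comm] at hap
    linarith
  rcases t.eq_empty_or_nonempty with rfl | hne
  · exact ⟨1, one_pos, fun a => by obtain ⟨p, hp, -⟩ := hsub a; exact hp.elim⟩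
  · obtain ⟨p₀, -, hp₀⟩ := Set.exists_min_image t
      (fun p => m.real (Metric.ball p (δ / 2))) htf hne
    exact ⟨_, hpos p₀, fun a => by
      obtain ⟨p, hp, hpa⟩ := hsub a
      exact (hp₀ p hp).trans hpa⟩

/-! ### Invariant measures and weak* limits. -/

section Invariance

variable {M : Type*} [MetricSpace M] [CompactSpace M] [MeasurableSpace M] [BorelSpace M]

theorem mem_invariantMeasures_of_forall_integral {μ : ProbabilityMeasure (ℕ → M)}
    (h : ∀ w : (ℕ → M) → ℝ, Continuous w →
      ∫ x, w (shift x) ∂(μ : Measure (ℕ → M)) = ∫ x, w x ∂(μ : Measure (ℕ → M))) :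
    μ ∈ invariantMeasures M := by
  have hs : Measurable (shift : (ℕ → M) → ℕ → M) := continuous_shift.measurable
  refine ⟨hs, ?_⟩
  have : IsProbabilityMeasure ((μ : Measure (ℕ → M)).map shift) :=
    Measure.isProbabilityMeasure_map hs.aemeasurable
  refine ext_of_forall_integral_eq_of_IsFiniteMeasure fun w => ?_
  rw [integral_map hs.aemeasurable w.continuous.aestronglyMeasurable]
  exact h w w.continuous

omit [CompactSpace M] in
theorem integral_comp_shift {μ : ProbabilityMeasure (ℕ → M)} (hμ : μ ∈ invariantMeasures M)
    [SecondCountableTopology M] {w : (ℕ → M) → ℝ} (hw : Continuous w) :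
    ∫ x, w (shift x) ∂(μ : Measure (ℕ → M)) = ∫ x, w x ∂(μ : Measure (ℕ → M)) := by
  have hμ' : MeasurePreserving (shift : (ℕ → M) → ℕ → M) (μ : Measure (ℕ → M)) μ := hμ
  conv_rhs => rw [← hμ'.map_eq]
  exact (integral_map hμ'.measurable.aemeasurable hw.aestronglyMeasurable).symm

theorem integral_iterate_shift {μ : ProbabilityMeasure (ℕ → M)} (hμ : μ ∈ invariantMeasures M)
    {w : (ℕ → M) → ℝ} (hw : Continuous w) (n : ℕ) :
    ∫ x, w (shift^[n] x) ∂(μ : Measure (ℕ → M)) = ∫ x, w x ∂(μ : Measure (ℕ → M)) := by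
  induction n with
  | zero => rfl
  | succ n ih =>
    rw [← ih]
    exact integral_comp_shift hμ (hw.comp (continuous_shift.iterate n))

theorem integral_birkhoffSum_shift {μ : ProbabilityMeasure (ℕ → M)}
    (hμ : μ ∈ invariantMeasures M) {w : (ℕ → M) → ℝ} (hw : Continuous w) (n : ℕ) :
    ∫ x, birkhoffSum shift w n x ∂(μ : Measure (ℕ → M)) =
      n * ∫ x, w x ∂(μ : Measure (ℕ → M)) := by
  simp only [birkhoffSum]
  rw [integral_finsetSum (f := fun k x => w (shift^[k] x)) _ fun k _ =>
    integrable_of_continuous _ (hw.comp (continuous_shift.iterate k))]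
  simp [integral_iterate_shift hμ hw]

theorem tendsto_integral_of_continuous {μ : ℕ → ProbabilityMeasure (ℕ → M)}
    {ν : ProbabilityMeasure (ℕ → M)} (h : Tendsto μ atTop (𝓝 ν)) {w : (ℕ → M) → ℝ}
    (hw : Continuous w) :
    Tendsto (fun j => ∫ x, w x ∂(μ j : Measure (ℕ → M))) atTop
      (𝓝 (∫ x, w x ∂(ν : Measure (ℕ → M)))) :=
  ProbabilityMeasure.tendsto_iff_forall_integral_tendsto.1 h
    (BoundedContinuousFunction.mkOfCompact ⟨w, hw⟩)

/-- The set of invariant probability measures is weakly* sequentially closed. -/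
theorem mem_invariantMeasures_of_tendsto {μ : ℕ → ProbabilityMeasure (ℕ → M)}
    {ν : ProbabilityMeasure (ℕ → M)} (h : Tendsto μ atTop (𝓝 ν))
    (hμ : ∀ j, μ j ∈ invariantMeasures M) : ν ∈ invariantMeasures M := by
  refine mem_invariantMeasures_of_forall_integral fun w hw => ?_
  refine tendsto_nhds_unique (tendsto_integral_of_continuous h (hw.comp continuous_shift)) ?_
  simpa only [Function.comp_apply, integral_comp_shift (hμ _) hw]
    using tendsto_integral_of_continuous h hw

end Invariance

/-! ### Gibbs probabilities and bounds on the eigenvalue. -/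

section Gibbs

variable {M : Type*} [MetricSpace M] [CompactSpace M] [MeasurableSpace M] [BorelSpace M]

theorem integral_withDensity_ofReal {ν : Measure (ℕ → M)} {h : (ℕ → M) → ℝ} (hc : Continuous h)
    (hpos : ∀ x, 0 < h x) (w : (ℕ → M) → ℝ) :
    ∫ x, w x ∂ν.withDensity (fun x => ENNReal.ofReal (h x)) = ∫ x, h x * w x ∂ν := by
  rw [integral_withDensity_eq_integral_toReal_smul hc.measurable.ennreal_ofReal
    (Filter.Eventually.of_forall fun _ => ENNReal.ofReal_lt_top)]
  simp [ENNReal.toReal_ofReal (hpos _).le]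

/-- Since `σ(ax) = x` for every `a`, the factor `v ∘ σ` is constant in the integral over `a`. -/
theorem ruelle_mul_comp_shift {M : Type*} [MeasurableSpace M] (m : Measure M) (g w v : (ℕ → M) → ℝ) (x : ℕ → M) :
    ruelle m g (fun y => w y * v (shift y)) x = ruelle m g w x * v x := by
  simp only [ruelle, shift_cons, ← mul_assoc]
  exact integral_mul_const _ _

/-- Testing `L_g^* ν = b ν` on `h · (w ∘ σ)` and using `L_g (h · (w ∘ σ)) = b h w` gives invariance
after cancelling `b`. -/
theorem IsGibbs.mem_invariantMeasures {m : Measure M} {g : (ℕ → M) → ℝ}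
    {μ : ProbabilityMeasure (ℕ → M)} (hμ : IsGibbs m g μ) : μ ∈ invariantMeasures M := by
  obtain ⟨b, h, ν, hb, ⟨hc, hpos, heig⟩, ⟨-, hν⟩, hμν⟩ := hμ
  refine mem_invariantMeasures_of_forall_integral fun w hw => ?_
  rw [hμν, integral_withDensity_ofReal hc hpos, integral_withDensity_ofReal hc hpos]
  have key := hν (fun x => h x * w (shift x)) (hc.mul (hw.comp continuous_shift))
  simp only [ruelle_mul_comp_shift, heig, mul_assoc] at key
  rw [integral_const_mul] at key
  exact (mul_left_cancel₀ hb.ne' key).symm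

/-- The entropy of a Gibbs probability is nonpositive: `log b ≤ ∫ g dμ`. -/
theorem IsGibbs.exists_log_le_integral {m : Measure M} [IsProbabilityMeasure m]
    {g : (ℕ → M) → ℝ} (hg : Continuous g) {μ : ProbabilityMeasure (ℕ → M)} (hμ : IsGibbs m g μ) :
    ∃ (b : ℝ) (h : (ℕ → M) → ℝ), 0 < b ∧ IsEigenfunction m g b h ∧
      Real.log b ≤ ∫ x, g x ∂(μ : Measure (ℕ → M)) := by
  have hinv := hμ.mem_invariantMeasures
  obtain ⟨b, h, ν, hb, hh, ⟨-, hν⟩, hμν⟩ := hμ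
  refine ⟨b, h, hb, hh, ?_⟩
  obtain ⟨hc, hpos, heig⟩ := hh
  have hlog : Continuous fun x => Real.log (h x) := hc.log fun x => (hpos x).ne'
  -- `F` is the normalized potential, `L_F 1 = 1`. The coboundary integrates to zero, so the claim
  -- is `∫ F dμ ≥ 0`.
  set F : (ℕ → M) → ℝ := fun x => g x + Real.log (h x) - Real.log (h (shift x)) - Real.log b
  have hF : Continuous F :=
    ((hg.add hlog).sub (hlog.comp continuous_shift)).sub continuous_const
  have hFint : ∫ x, F x ∂(μ : Measure (ℕ → M)) =
      ∫ x, g x ∂(μ : Measure (ℕ → M)) - Real.log b := by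
    have i1 := integrable_of_continuous (μ : Measure (ℕ → M)) hg
    have i2 := integrable_of_continuous (μ : Measure (ℕ → M)) hlog
    have i3 : Integrable (fun x => Real.log (h (shift x))) (μ : Measure (ℕ → M)) :=
      integrable_of_continuous _ (hlog.comp continuous_shift)
    have i12 : Integrable (fun x => g x + Real.log (h x)) (μ : Measure (ℕ → M)) := i1.add i2
    have i123 : Integrable (fun x => g x + Real.log (h x) - Real.log (h (shift x)))
      (μ : Measure (ℕ → M)) := i12.sub i3
    have e3 := integral_comp_shift hinv hlog
    have e : ∫ x, F x ∂(μ : Measure (ℕ → M)) = ∫ x, g x ∂(μ : Measure (ℕ → M)) +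
        ∫ x, Real.log (h x) ∂(μ : Measure (ℕ → M)) -
        ∫ x, Real.log (h (shift x)) ∂(μ : Measure (ℕ → M)) - Real.log b := by
      rw [← integral_add i1 i2, ← integral_sub i12 i3,
        integral_sub i123 (integrable_const _)]
      simp
    rw [e, e3]
    ring
  have hFnonneg : 0 ≤ ∫ x, F x ∂(μ : Measure (ℕ → M)) := by
    rw [hμν, integral_withDensity_ofReal hc hpos]
    refine nonneg_of_mul_nonneg_right ((hν _ (hc.mul hF)).symm ▸ ?_) hb
    refine integral_nonneg fun x => ?_
    have hcw : Continuous fun a => Real.exp (g (cons a x)) * h (cons a x) :=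
      (hg.rexp.mul hc).comp (continuous_cons x)
    have hcF : Continuous fun a => Real.exp (g (cons a x)) * (h (cons a x) * F (cons a x)) :=
      (hg.rexp.mul (hc.mul hF)).comp (continuous_cons x)
    have hx : 0 < b * h x := mul_pos hb (hpos x)
    -- This is `q - p ≤ q log (q / p)` with `p = b h(x)`; the left side integrates to `L_g h - b h =
    -- 0`.
    have hle : ∀ a, Real.exp (g (cons a x)) * h (cons a x) - b * h x ≤
        Real.exp (g (cons a x)) * (h (cons a x) * F (cons a x)) := by
      intro a
      set q := Real.exp (g (cons a x)) * h (cons a x) with hq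
      have hqpos : 0 < q := mul_pos (Real.exp_pos _) (hpos _)
      have hFq : F (cons a x) = Real.log q - Real.log (b * h x) := by
        rw [hq, Real.log_mul (Real.exp_pos _).ne' (hpos _).ne', Real.log_exp,
          Real.log_mul hb.ne' (hpos x).ne']
        simp only [F, shift_cons]
        ring
      have hl := Real.log_le_sub_one_of_pos (div_pos hx hqpos)
      rw [Real.log_div hx.ne' hqpos.ne'] at hl
      have hm := mul_le_mul_of_nonneg_left hl hqpos.le
      rw [mul_sub q (b * h x / q) 1, mul_div_cancel₀ _ hqpos.ne'] at hm
      rw [← mul_assoc, ← hq, hFq]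
      linarith
    calc (0 : ℝ) = ruelle m g h x - b * h x := by rw [heig, sub_self]
      _ = ∫ a, (Real.exp (g (cons a x)) * h (cons a x) - b * h x) ∂m := by
          rw [integral_sub (integrable_of_continuous m hcw) (integrable_const _)]
          simp [ruelle]
      _ ≤ _ := integral_mono ((integrable_of_continuous m hcw).sub (integrable_const _))
          (integrable_of_continuous m hcF) hle
  linarith

/-- Lower bound for a positive eigenfunction along sequences that are close to an orbit. -/
theorem IsEigenfunction.le_of_dist_lt {m : Measure M} [IsProbabilityMeasure m]
    {f : (ℕ → M) → ℝ} (hf : Continuous f) {c b κ δ ε h₀ : ℝ} (hc : 0 ≤ c) (hb : 0 < b)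
    (hκ : 0 ≤ κ) (hball : ∀ a, κ ≤ m.real (Metric.ball a δ))
    (hmod : ∀ x y : ℕ → M, (∀ i, dist (x i) (y i) < δ) → |f x - f y| ≤ ε)
    {h : (ℕ → M) → ℝ} (hh : IsEigenfunction m (fun x => c * f x) b h) (hh₀ : 0 ≤ h₀)
    (hmin : ∀ x, h₀ ≤ h x) (n : ℕ) (y z : ℕ → M) (hz : ∀ i, dist (z i) (shift^[n] y i) < δ) :
    h₀ * (κ * Real.exp (-(c * ε)) / b) ^ n * Real.exp (c * birkhoffSum shift f n y) ≤ h z := by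
  obtain ⟨hcont, hpos, heig⟩ := hh
  induction n generalizing z with
  | zero => simpa using hmin z
  | succ n ih =>
    set u := shift^[n] y with hu
    set B := h₀ * (κ * Real.exp (-(c * ε)) / b) ^ n * Real.exp (c * birkhoffSum shift f n y)
      with hB
    have hB0 : 0 ≤ B := by positivity
    set K := Real.exp (c * (f u - ε)) * B
    have hK0 : 0 ≤ K := by positivity
    have hcw : Continuous fun a => Real.exp (c * f (cons a z)) * h (cons a z) :=
      (((continuous_const.mul hf).rexp).mul hcont).comp (continuous_cons z)
    have hint := integrable_of_continuous m hcw
    -- Prepending to `z` a symbol `δ`-close to `u 0` gives a sequence coordinatewise `δ`-close to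
    -- `u`, to which the induction hypothesis applies.
    have hle : ∀ a ∈ Metric.ball (u 0) δ, K ≤ Real.exp (c * f (cons a z)) * h (cons a z) := by
      intro a ha
      have hclose : ∀ i, dist (cons a z i) (u i) < δ := by
        rintro (_ | i)
        · exact ha
        · have := hz i
          rwa [Function.iterate_succ_apply'] at this
      have hfd := (abs_le.1 (hmod _ _ hclose)).1
      refine mul_le_mul (Real.exp_le_exp.2 (mul_le_mul_of_nonneg_left ?_ hc)) (ih _ hclose) hB0
        (Real.exp_pos _).le
      linarith
    have hstep : κ * K ≤ b * h z := by
      calc κ * K ≤ m.real (Metric.ball (u 0) δ) * K := by gcongr; exact hball _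
        _ = ∫ _ in Metric.ball (u 0) δ, K ∂m := by simp
        _ ≤ ∫ a in Metric.ball (u 0) δ, Real.exp (c * f (cons a z)) * h (cons a z) ∂m :=
            setIntegral_mono_on (integrable_const _) hint.integrableOn
              Metric.isOpen_ball.measurableSet hle
        _ ≤ ∫ a, Real.exp (c * f (cons a z)) * h (cons a z) ∂m :=
            setIntegral_le_integral hint
              (Filter.Eventually.of_forall fun a => (mul_pos (Real.exp_pos _) (hpos _)).le)
        _ = b * h z := heig z
    rw [birkhoffSum_succ, ← hu]
    refine le_of_mul_le_mul_left (le_of_eq_of_le ?_ hstep) hb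
    have e1 : Real.exp (c * (f u - ε)) = Real.exp (c * f u) * Real.exp (-(c * ε)) := by
      rw [← Real.exp_add]; ring_nf
    simp only [K, hB, mul_add, Real.exp_add, e1, pow_succ]
    field_simp

/-- The eigenvalue of a positive eigenfunction bounds every `∫ f dη` from above, up to an error
governed by the a priori measure of balls. -/
theorem IsEigenfunction.le_log {m : Measure M} [IsProbabilityMeasure m]
    {f : (ℕ → M) → ℝ} (hf : Continuous f) {c b κ δ ε : ℝ} (hc : 0 ≤ c) (hb : 0 < b)
    (hκ : 0 < κ) (hδ : 0 < δ) (hball : ∀ a, κ ≤ m.real (Metric.ball a δ))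
    (hmod : ∀ x y : ℕ → M, (∀ i, dist (x i) (y i) < δ) → |f x - f y| ≤ ε)
    {h : (ℕ → M) → ℝ} (hh : IsEigenfunction m (fun x => c * f x) b h)
    {η : ProbabilityMeasure (ℕ → M)} (hη : η ∈ invariantMeasures M) :
    Real.log κ + c * (∫ x, f x ∂(η : Measure (ℕ → M)) - ε) ≤ Real.log b := by
  have : Nonempty (ℕ → M) := η.nonempty
  obtain ⟨x₀, -, hx₀⟩ := isCompact_univ.exists_isMinOn Set.univ_nonempty hh.1.continuousOn
  obtain ⟨x₁, -, hx₁⟩ := isCompact_univ.exists_isMaxOn Set.univ_nonempty hh.1.continuousOn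
  have h₀ : 0 < h x₀ := hh.2.1 x₀
  set A := Real.log κ - c * ε - Real.log b
  -- The lower bound is taken at `z = σⁿ y` and compared with the maximum of `h`.
  have hpt : ∀ (n : ℕ) (y : ℕ → M), Real.log (h x₀) + n * A + c * birkhoffSum shift f n y ≤
      Real.log (h x₁) := by
    intro n y
    have hy := (hh.le_of_dist_lt hf hc hb hκ.le hball hmod h₀.le (fun x => hx₀ (Set.mem_univ x))
      n y (shift^[n] y) (by simp [hδ])).trans (hx₁ (Set.mem_univ _))
    have hl := Real.log_le_log (by positivity) hy
    rwa [Real.log_mul (by positivity) (by positivity), Real.log_mul h₀.ne' (by positivity),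
      Real.log_pow, Real.log_exp, Real.log_div (by positivity) hb.ne',
      Real.log_mul hκ.ne' (by positivity), Real.log_exp, ← sub_eq_add_neg] at hl
  have hint : ∀ n : ℕ, n * (A + c * ∫ x, f x ∂(η : Measure (ℕ → M))) ≤
      Real.log (h x₁) - Real.log (h x₀) := by
    intro n
    have hcS : Continuous fun y => birkhoffSum shift f n y :=
      continuous_finsetSum _ fun k _ => hf.comp (continuous_shift.iterate k)
    have hiS := (integrable_of_continuous (η : Measure (ℕ → M)) hcS).const_mul c
    have hi : ∫ y, (Real.log (h x₀) + n * A + c * birkhoffSum shift f n y)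
        ∂(η : Measure (ℕ → M)) ≤ ∫ _, Real.log (h x₁) ∂(η : Measure (ℕ → M)) :=
      integral_mono ((integrable_const _).add hiS) (integrable_const _) (hpt n)
    rw [integral_add (integrable_const _) hiS, integral_const_mul,
      integral_birkhoffSum_shift hη hf] at hi
    simp only [integral_const, probReal_univ, one_smul] at hi
    linarith
  -- Its multiples by all `n` stay below the oscillation of `log h`.
  have hnonpos : A + c * ∫ x, f x ∂(η : Measure (ℕ → M)) ≤ 0 := by
    by_contra! hp
    obtain ⟨n, hn⟩ := exists_nat_gt ((Real.log (h x₁) - Real.log (h x₀)) /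
      (A + c * ∫ x, f x ∂(η : Measure (ℕ → M))))
    rw [div_lt_iff₀ hp] at hn
    exact absurd (hint n) hn.not_ge
  simp only [A] at hnonpos
  linarith

/-- Weak* limits of Gibbs probabilities at zero temperature are maximizing. -/
theorem isMaximizing_of_tendsto {m : Measure M} [IsProbabilityMeasure m] [m.IsOpenPosMeasure]
    {f : (ℕ → M) → ℝ} (hf : IsHolder f) {c : ℕ → ℝ} (hc : Tendsto c atTop atTop)
    {μ : ℕ → ProbabilityMeasure (ℕ → M)} (hμ : ∀ j, IsGibbs m (fun x => c j * f x) (μ j))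
    {μlim : ProbabilityMeasure (ℕ → M)} (hlim : Tendsto μ atTop (𝓝 μlim)) :
    IsMaximizing f μlim := by
  have hfc := hf.continuous
  have hinv : μlim ∈ invariantMeasures M :=
    mem_invariantMeasures_of_tendsto hlim fun j => (hμ j).mem_invariantMeasures
  refine ⟨hinv, ⟨μlim, hinv, rfl⟩, ?_⟩
  rintro _ ⟨η, hη, rfl⟩
  refine le_of_forall_pos_le_add fun ε hε => ?_
  -- `δ` and `κ` are chosen from `ε` alone, before `j` varies.
  obtain ⟨δ, hδ, hmod⟩ := hf.exists_modulus hε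
  obtain ⟨κ, hκ, hball⟩ := exists_pos_le_measureReal_ball m hδ
  have hbound : ∀ᶠ j in atTop, Real.log κ / c j + (∫ x, f x ∂(η : Measure (ℕ → M)) - ε) ≤
      ∫ x, f x ∂(μ j : Measure (ℕ → M)) := by
    filter_upwards [hc.eventually_gt_atTop 0] with j hj
    have hcf : Continuous fun x => c j * f x := continuous_const.mul hfc
    obtain ⟨b, h, hb, hh, hle⟩ := (hμ j).exists_log_le_integral hcf
    rw [integral_const_mul] at hle
    have := (hh.le_log hfc hj.le hb hκ hδ hball hmod hη).trans hle
    refine le_of_mul_le_mul_left ?_ hj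
    rwa [mul_add, mul_div_cancel₀ _ hj.ne']
  have hl : Tendsto (fun j => Real.log κ / c j + (∫ x, f x ∂(η : Measure (ℕ → M)) - ε)) atTop
      (𝓝 (0 + (∫ x, f x ∂(η : Measure (ℕ → M)) - ε))) :=
    (hc.const_div_atTop _).add_const _
  have := le_of_tendsto_of_tendsto hl (tendsto_integral_of_continuous hlim hfc) hbound
  simp only
  linarith

end Gibbs

end XYModel

theorem theorem1 {n : ℕ} {H : Type*} [TopologicalSpace H]
    (I : ModelWithCorners ℝ (EuclideanSpace ℝ (Fin n)) H)
    {M : Type*} [MetricSpace M] [CompactSpace M] [ConnectedSpace M]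
    [ChartedSpace H M] [IsManifold I 1 M]
    [MeasurableSpace M] [BorelSpace M]
    (m : Measure M) (hm : XYModel.IsLebesgueProbability I m)
    (f : (ℕ → M) → ℝ) (hf : XYModel.IsHolder f)
    (c : ℕ → ℝ) (hc : Tendsto c atTop atTop)
    (μ : ℕ → ProbabilityMeasure (ℕ → M))
    (hμ : ∀ j, XYModel.IsGibbs m (fun x => c j * f x) (μ j))
    (μlim : ProbabilityMeasure (ℕ → M)) (hlim : Tendsto μ atTop (𝓝 μlim)) :
    XYModel.IsMaximizing f μlim ∧
      ∫ x, f x ∂(μlim : Measure (ℕ → M)) = XYModel.maxValue f := by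

  have := hm.1
  have := hm.isOpenPosMeasure
  have hmax := XYModel.isMaximizing_of_tendsto hf hc hμ hlim
  exact ⟨hmax, hmax.2.csSup_eq.symm⟩
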